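/- For integers $p,q\ge 1$, $m\ge 2$ and $n\ge\max\{m,3\}$ put $S=\{0,\dots,m-1\}$ and $C=\{0,\dots,n-1\}$. A marked graph $G[x;y;R]$ is a finite simple graph $G$ with pairwise distinct designated vertices $x_0,\dots,x_{p-1}$ (inputs), $y_0,\dots,y_{q-1}$ (outputs) and $\tilde 0,\dots,\widetilde{n-1}$ (the reference set $R$). It simulates a partial function $\varphi:S^p\to S^q$ through $n$-colorings if (i) $G$ is $n$-colorable; (ii) in every proper $n$-coloring of $G$ the vertices of $R$ have pairwise distinct colors; (iii) for every assignment $\sigma_0$ of colors from $C$ to the inputs and to $R$ with $\sigma_0(\tilde i)=i$ for all $0\le i<n$: $\sigma_0$ extends to a proper $C$-coloring $\sigma$ of $G$ if and only if $(\sigma_0(x_0),\dots,\sigma_0(x_{p-1}))$ lies in the domain of $\varphi$ (in particular all these colors lie in $S$), and in that case $\sigma$ is unique and $\varphi(\sigma(x_0),\dots,\sigma(x_{p-1}))=(\sigma(y_0),\dots,\sigma(y_{q-1}))$. For $m'\ge m$, $r\ge\max\{p,q\}$ and $s_0\in S$, an $(m',r,s_0)$-invertible extension of $\varphi$ is a permutation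 $\tilde\varphi$ of $\{0,\dots,m'-1\}^r$ such that for every $u$ in the domain of $\varphi$ the first $q$ coordinates of $\tilde\varphi(u,s_0,\dots,s_0)$ are $\varphi(u)$. Theorem. There is an absolute constant $K$ such that for all $p,q\ge1$, $m\ge2$, $n\ge\max\{m,3\}$ and every partial function $\varphi:S^p\to S^q$ with non-empty domain there is a marked graph $G=G_{\varphi,n}[x;y;R]$ in which $R$ is a clique and which simulates $\varphi$ through $n$-colorings. Moreover, whenever some $(m',p+q,s_0)$-invertible extension of $\varphi$ (with $m'\ge m$, $s_0\in S$) is a product of $\Theta$ transpositions, $$|V(G)|\le K\,\max\{1,\Theta\}\,(p+q)\,n^{2(p+q)+4}\quad\text{and}\quad |E(G)|\le K\,\max\{1,\Theta\}\,(p+q)\,n^{3(p+q)+5}.$$ -/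

import Mathlib

namespace ColoringSim

/-- A finite simple graph `G[x; y; R]` with `p` input vertices, `q` output vertices and `n`
reference vertices.  All these marked vertices are pairwise distinct. -/
structure MarkedGraph (p q n : ℕ) where
  V : Type
  finite : Finite V
  graph : SimpleGraph V
  x : Fin p → V
  y : Fin q → V
  ref : Fin n → V
  marking_injective : Function.Injective (Sum.elim x (Sum.elim y ref))

/-- Number of vertices. -/
noncomputable def MarkedGraph.numVertices {p q n : ℕ} (M : MarkedGraph p q n) : ℕ :=
  Nat.card M.V

/-- Number of edges. -/
noncomputable def MarkedGraph.numEdges {p q n : ℕ} (M : MarkedGraph p q n) : ℕ :=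
  M.graph.edgeSet.ncard

/-- The reference vertices induce a complete graph. -/
def MarkedGraph.RefClique {p q n : ℕ} (M : MarkedGraph p q n) : Prop :=
  M.graph.IsClique (Set.range M.ref)

/-- The proper coloring `σ` of the whole graph extends the assignment of colors on `X ∪ R` that
gives the color `a j` to the `j`-th input vertex and the color `i` to the `i`-th
reference vertex. -/
def MarkedGraph.Extends {p q n : ℕ} (M : MarkedGraph p q n) (a : Fin p → Fin n)
    (σ : M.graph.Coloring (Fin n)) : Prop :=
  (∀ j, σ (M.x j) = a j) ∧ ∀ i, σ (M.ref i) = i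

/-- The tuple of colors (elements of `{0, …, n-1}`) `a` and the tuple of
symbols (elements of `{0, …, m-1}`) `s` are the same tuple of numbers. -/
def SameTuple {k n m : ℕ} (a : Fin k → Fin n) (s : Fin k → Fin m) : Prop :=
  ∀ j, (a j : ℕ) = (s j : ℕ)

/-- The marked graph `M` simulates the partial function `φ : S^p → S^q`, `S = {0, …, m-1}`,
through `n`-colorings. -/
structure Simulates {p q m n : ℕ} (M : MarkedGraph p q n)
    (φ : (Fin p → Fin m) →. (Fin q → Fin m)) : Prop where
  colorable : M.graph.Colorable n
  ref_distinct : ∀ σ : M.graph.Coloring (Fin n), Function.Injective (fun i => σ (M.ref i))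
  extends_iff : ∀ a : Fin p → Fin n,
    (∃ σ, M.Extends a σ) ↔ ∃ s : Fin p → Fin m, s ∈ φ.Dom ∧ SameTuple a s
  extension_unique : ∀ (a : Fin p → Fin n) (σ τ : M.graph.Coloring (Fin n)),
    M.Extends a σ → M.Extends a τ → σ = τ
  output : ∀ (a : Fin p → Fin n) (σ : M.graph.Coloring (Fin n)), M.Extends a σ →
    ∃ (s : Fin p → Fin m) (t : Fin q → Fin m),
      SameTuple a s ∧ t ∈ φ s ∧ SameTuple (fun j => σ (M.y j)) t

/-- The tuple `(a, s₀, …, s₀)` of length `r`, over the larger symbol set `{0, …, m' - 1}`. -/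
def pad {p m m' : ℕ} (h : m ≤ m') (r : ℕ) (s₀ : Fin m) (a : Fin p → Fin m) : Fin r → Fin m' :=
  fun i => if hi : (i : ℕ) < p then Fin.castLE h (a ⟨i, hi⟩) else Fin.castLE h s₀

/-- The permutation `π` of `{0, …, m' - 1}^r` is an `(m', r, s₀)`-invertible extension of the
partial function `φ`: whenever `φ(a) = b`, the tuple `π(a, s₀, …, s₀)` begins with `b`. -/
def IsInvertibleExtension {p q m m' r : ℕ} (h : m ≤ m') (hq : q ≤ r) (s₀ : Fin m)
    (φ : (Fin p → Fin m) →. (Fin q → Fin m)) (π : Equiv.Perm (Fin r → Fin m')) : Prop :=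
  ∀ a b, b ∈ φ a → ∀ j : Fin q, π (pad h r s₀ a) (Fin.castLE hq j) = Fin.castLE h (b j)

/-- The permutation `π` can be presented using `Θ` transpositions. -/
def IsProductOfTranspositions {α : Type} [DecidableEq α] (π : Equiv.Perm α) (Θ : ℕ) : Prop :=
  ∃ l : List (Equiv.Perm α), (∀ τ ∈ l, τ.IsSwap) ∧ l.prod = π ∧ l.length = Θ

end ColoringSim

namespace ColoringSim

/-! Index the domain of `φ` by `Fin N` and let vertices be functions `Fin N → Fin n`, adjacent when
they differ everywhere. Evaluation at a point is then a proper coloring; the vertices are chosen so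
that no other coloring fixes the constants. On the functions constant on the cells of a 3-cell
partition, such a coloring is an idempotent polymorphism of a complete graph on at least 3 vertices,
hence a projection: it selects a cell. Selected cells meet pairwise; the threshold partitions thus
single out a point `d`, and level sets force the marked vertices to take their values at `d`. -/

/-- A coloring of the square of a complete graph that fixes the diagonal is a projection. -/
theorem binary_projection {C : Type*} (h : C → C → C)
    (mem : ∀ a b, h a b = a ∨ h a b = b)
    (diff : ∀ a b a' b', a ≠ a' → b ≠ b' → h a b ≠ h a' b') :
    (∀ a b, h a b = a) ∨ (∀ a b, h a b = b) := by
  by_contra! hcon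
  obtain ⟨⟨a, b, hab⟩, c, d, hcd⟩ := hcon
  have hd : h c d = c := (mem c d).resolve_right hcd
  have hne : c ≠ d := fun e => hcd (by rw [hd, e])
  -- Otherwise `h c a = a = h a b`, though the two pairs differ in both coordinates. Two
  -- applications reach every off-diagonal pair.
  have step : ∀ a b, a ≠ b → h a b = a → ∀ c, c ≠ a → h c a = c := by
    intro a b hab h1 c hca
    refine (mem c a).resolve_right fun h2 => ?_
    exact diff a b c a hca.symm hab.symm (h1.trans h2.symm)
  have h1 := step c d hne hd
  have h2 : ∀ u v, u ≠ v → v ≠ c → h u v = u := fun u v huv hv =>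
    step v c hv (h1 v hv) u huv
  have hba : h a b = b := (mem a b).resolve_left hab
  have hab' : a ≠ b := fun e => hab (by rw [hba, e])
  by_cases hbc : b = c
  · subst hbc; exact hab (h1 a hab')
  · exact hab (h2 a b hab' hbc)

theorem exists_ne_ne {C : Type*} [Fintype C] (hC : 3 ≤ Fintype.card C) (a b : C) :
    ∃ c, c ≠ a ∧ c ≠ b := by
  classical
  have h : ∃ c, c ∉ ({a, b} : Finset C) := by
    by_contra! hcon
    have := Finset.card_le_card (fun c _ => hcon c : Finset.univ ⊆ ({a, b} : Finset C))
    have h2 := Finset.card_le_two (a := a) (b := b)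
    rw [Finset.card_univ] at this
    omega
  simpa using h

/-- A coloring of the third categorical power of a complete graph with at least three vertices
that fixes the diagonal is a projection. -/
theorem ternary_projection {C : Type*} [Fintype C] (hC : 3 ≤ Fintype.card C)
    (g : (Fin 3 → C) → C) (idem : ∀ c, g (fun _ => c) = c)
    (diff : ∀ s t, (∀ i, s i ≠ t i) → g s ≠ g t) :
    ∃ i, ∀ t, g t = t i := by
  classical
  have mem : ∀ t, ∃ i, g t = t i := by
    intro t
    by_contra! hcon
    exact diff (fun _ => g t) t hcon (idem _)
  have dich : ∀ i : Fin 3, (∀ a b, g (fun j => if j = i then a else b) = a) ∨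
      (∀ a b, g (fun j => if j = i then a else b) = b) := by
    intro i
    apply binary_projection (fun a b => g (fun j => if j = i then a else b))
    · intro a b
      obtain ⟨j, hj⟩ := mem (fun j => if j = i then a else b)
      rw [hj]
      by_cases h : j = i <;> simp [h]
    · intro a b a' b' ha hb
      apply diff
      intro j
      by_cases h : j = i <;> simp [h, ha, hb]
  by_contra! hcon
  have maj : ∀ i : Fin 3, ∀ a b, g (fun j => if j = i then a else b) = b := by
    intro i
    refine (dich i).resolve_left fun hi => ?_
    -- The tuple with `g t` at `i` and `f` elsewhere will differ from `t` everywhere, yet also have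
    -- value `g t`.
    obtain ⟨t, ht⟩ := hcon i
    obtain ⟨f, hf⟩ : ∃ f, ∀ j, j ≠ i → f ≠ t j := by
      fin_cases i
      · obtain ⟨f, h1, h2⟩ := exists_ne_ne hC (t 1) (t 2)
        exact ⟨f, fun j hj => by fin_cases j <;> simp_all⟩
      · obtain ⟨f, h1, h2⟩ := exists_ne_ne hC (t 0) (t 2)
        exact ⟨f, fun j hj => by fin_cases j <;> simp_all⟩
      · obtain ⟨f, h1, h2⟩ := exists_ne_ne hC (t 0) (t 1)
        exact ⟨f, fun j hj => by fin_cases j <;> simp_all⟩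
    refine diff (fun j => if j = i then g t else f) t (fun j => ?_) (hi _ _)
    by_cases h : j = i
    · simpa [h] using ht
    · simpa [h] using hf j h
  -- Now `g` is a majority operation. If, say, `g (a, b, c) = a`, then `(b, a, a)` has the same
  -- value and differs everywhere.
  obtain ⟨a⟩ : Nonempty C := Fintype.card_pos_iff.mp (by omega)
  obtain ⟨b, hb, -⟩ := exists_ne_ne hC a a
  obtain ⟨c, hca, hcb⟩ := exists_ne_ne hC a b
  obtain ⟨i, hi⟩ := mem ![a, b, c]
  fin_cases i
  · refine diff _ ![a, b, c] (fun j => ?_) ((maj 0 b a).trans hi.symm)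
    fin_cases j <;> simp [hb, hb.symm, hca.symm]
  · refine diff _ ![a, b, c] (fun j => ?_) ((maj 1 c b).trans hi.symm)
    fin_cases j <;> simp [hb, hcb, hcb.symm]
  · refine diff _ ![a, b, c] (fun j => ?_) ((maj 2 a c).trans hi.symm)
    fin_cases j <;> simp [hca, hcb, hca.symm]

/-! ### Colorings as evaluations -/

/-- Two functions indexed by the vertices are adjacent when they differ at every point. -/
def evalGraph {V D C : Type*} [Nonempty D] (ev : V → D → C) : SimpleGraph V where
  Adj v w := ∀ d, ev v d ≠ ev w d
  symm := ⟨fun _ _ h d => (h d).symm⟩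
  loopless := ⟨fun _ h => h (Classical.arbitrary _) rfl⟩

/-- Evaluation at a point colors `evalGraph`. -/
def evalColoring {V D C : Type*} [Nonempty D] (ev : V → D → C) (d : D) :
    (evalGraph ev).Coloring C :=
  SimpleGraph.Coloring.mk (fun v => ev v d) fun h => h d

section Evaluation

variable {ι : Type} {N n : ℕ} (X : ι → Fin N → Fin n)

/-- Partitions of `Fin N` into three cells: by comparison with a point, and by a level set of one
of the functions `X i`. -/
def cell : Fin N ⊕ ι × Fin n → Fin N → Fin 3
  | .inl d, z => if z < d then 0 else if z = d then 1 else 2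
  | .inr (i, e), z => if X i z = e then 1 else 0

/-- The vertices of the simulating graph: marked vertices, references, and all functions
constant on the cells of one of the partitions `cell X`. -/
abbrev Vert (ι : Type) (N n : ℕ) : Type :=
  (ι ⊕ Fin n) ⊕ (Fin N ⊕ ι × Fin n) × (Fin 3 → Fin n)

/-- The function carried by a vertex. -/
def eval : Vert ι N n → Fin N → Fin n
  | .inl (.inl i), z => X i z
  | .inl (.inr c), _ => c
  | .inr (P, t), z => t (cell X P z)

/-- Every coloring of the graph that fixes the reference colors is an evaluation. -/
theorem coloring_eq_eval [Nonempty (Fin N)] (hn : 3 ≤ n)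
    (σ : (evalGraph (eval X)).Coloring (Fin n)) (hσ : ∀ c, σ (.inl (.inr c)) = c) :
    ∃ d, ∀ v, σ v = eval X v d := by
  have hC : 3 ≤ Fintype.card (Fin n) := by simpa using hn
  have diff : ∀ v w, (∀ d, eval X v d ≠ eval X w d) → σ v ≠ σ w := fun v w h => σ.valid h
  have proj : ∀ P, ∃ k, ∀ t, σ (.inr (P, t)) = t k := by
    intro P
    apply ternary_projection hC (fun t => σ (.inr (P, t)))
    · intro c
      by_contra hne
      refine diff (.inr (P, fun _ => c)) (.inl (.inr (σ (.inr (P, fun _ => c))))) ?_ (hσ _).symm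
      intro _
      exact fun h => hne h.symm
    · intro s t hst
      exact diff _ _ fun d => hst _
  choose τ hτ using proj
  have c01 : (⟨0, by omega⟩ : Fin n) ≠ ⟨1, by omega⟩ := by simp
  have c02 : (⟨0, by omega⟩ : Fin n) ≠ ⟨2, by omega⟩ := by simp
  have c12 : (⟨1, by omega⟩ : Fin n) ≠ ⟨2, by omega⟩ := by simp
  generalize (⟨0, by omega⟩ : Fin n) = a at c01 c02
  generalize (⟨1, by omega⟩ : Fin n) = b at c01 c12
  generalize (⟨2, by omega⟩ : Fin n) = c at c02 c12
  -- On disjoint selected cells, "`a` on the cell, `b` off it" and "`a` on the cell, `c` off it" are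
  -- adjacent, yet both get color `a`.
  have meet : ∀ P Q, ∃ z, cell X P z = τ P ∧ cell X Q z = τ Q := by
    intro P Q
    by_contra! hcon
    refine diff (.inr (P, fun k => if k = τ P then a else b))
      (.inr (Q, fun k => if k = τ Q then a else c)) (fun z => ?_) (by simp [hτ])
    by_cases h1 : cell X P z = τ P
    · simp [eval, h1, hcon z h1, c02]
    · by_cases h2 : cell X Q z = τ Q <;> simp [eval, h1, h2, c01.symm, c12]
  have lt_of : ∀ {d z : Fin N}, cell X (.inl d) z = 0 → z < d := by
    intro d z h
    by_contra h'
    by_cases h2 : z = d <;> simp [cell, h', h2] at h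
  have eq_of : ∀ {d z : Fin N}, cell X (.inl d) z = 1 → z = d := by
    intro d z h
    by_contra h'
    by_cases h2 : z < d <;> simp [cell, h', h2] at h
  have gt_of : ∀ {d z : Fin N}, cell X (.inl d) z = 2 → d < z := by
    intro d z h
    by_contra h'
    rcases lt_or_eq_of_le (not_lt.mp h') with h2 | h2 <;> simp [cell, h2] at h
  have three : ∀ k : Fin 3, k ≠ 1 → k ≠ 0 → k = 2 := by decide
  -- If no singleton is selected, the upper cell is selected at every threshold: nothing lies below
  -- the first, nor strictly between consecutive ones. But nothing lies above the last.
  obtain ⟨d, hd⟩ : ∃ d, τ (.inl d) = 1 := by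
    by_contra! hcon
    have all : ∀ j (hj : j < N), τ (.inl ⟨j, hj⟩) = 2 := by
      intro j
      induction j with
      | zero =>
        intro hj
        refine three _ (hcon _) fun h => ?_
        obtain ⟨z, hz, -⟩ := meet (.inl ⟨0, hj⟩) (.inl ⟨0, hj⟩)
        have := lt_of (hz.trans h)
        simp [Fin.lt_def] at this
      | succ j ih =>
        intro hj
        refine three _ (hcon _) fun h => ?_
        obtain ⟨z, hz, hz'⟩ := meet (.inl ⟨j, by omega⟩) (.inl ⟨j + 1, hj⟩)
        have h1 := gt_of (hz.trans (ih (by omega)))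
        have h2 := lt_of (hz'.trans h)
        simp only [Fin.lt_def] at h1 h2
        omega
    have hN : 0 < N := Fin.pos (Classical.arbitrary (Fin N))
    obtain ⟨z, hz, -⟩ := meet (.inl ⟨N - 1, by omega⟩) (.inl ⟨N - 1, by omega⟩)
    have h1 := gt_of (hz.trans (all _ _))
    have h2 := z.isLt
    simp only [Fin.lt_def] at h1
    omega
  have hcell : ∀ P, τ P = cell X P d := by
    intro P
    obtain ⟨z, hz, hz'⟩ := meet (.inl d) P
    rw [← eq_of (hz.trans hd), hz']
  refine ⟨d, ?_⟩
  rintro ((i | c) | ⟨P, t⟩)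
  · by_contra hne
    -- A wrong color `σ (x i)` has a level set missing `d`. The function equal to `f` on that set
    -- and to the wrong color off it is adjacent to the marked vertex and has its color.
    obtain ⟨f, hf, -⟩ := exists_ne_ne hC (σ (.inl (.inl i))) (σ (.inl (.inl i)))
    refine diff (.inl (.inl i)) (.inr (.inr (i, σ (.inl (.inl i))),
      fun k => if k = 1 then f else σ (.inl (.inl i)))) (fun z => ?_) ?_
    · by_cases h : X i z = σ (.inl (.inl i)) <;> simp [eval, cell, h, hf.symm]
    · have : X i d ≠ σ (.inl (.inl i)) := fun h => hne h.symm
      simp [hτ, hcell, cell, this]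
  · exact hσ c
  · rw [hτ, hcell, eval]

end Evaluation

/-! ### Size bounds -/

theorem ncard_edgeSet_le_sq {V : Type} [Finite V] (G : SimpleGraph V) :
    G.edgeSet.ncard ≤ Nat.card V ^ 2 := by
  have h1 : G.edgeSet.ncard ≤ Nat.card (Sym2 V) := Set.ncard_le_card _
  have h2 : Nat.card (Sym2 V) ≤ Nat.card (V × V) :=
    Nat.card_le_card_of_surjective (Quot.mk _) Quot.mk_surjective
  rw [Nat.card_prod, ← sq] at h2
  exact h1.trans h2

theorem card_vert_le {p q n N : ℕ} (hp : 1 ≤ p) (hq : 1 ≤ q) (hn : 3 ≤ n) (hN : N ≤ n ^ p) :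
    Nat.card (Vert (Fin p ⊕ Fin q) N n) ≤ 4 * ((p + q) * n ^ (p + q + 2)) := by
  have hcard : Nat.card (Vert (Fin p ⊕ Fin q) N n) = (p + q + n) + (N + (p + q) * n) * n ^ 3 := by
    simp [Nat.card_eq_fintype_card]
  rw [hcard]
  have h1 : 1 ≤ n ^ (p + q + 2) := Nat.one_le_pow _ _ (by omega)
  have h2 : n ≤ n ^ (p + q + 2) := Nat.le_self_pow (by omega) n
  have h3 : n ^ p * n ^ 3 ≤ n ^ (p + q + 2) := by
    rw [← pow_add]; exact Nat.pow_le_pow_right (by omega) (by omega)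
  have h4 : n * n ^ 3 ≤ n ^ (p + q + 2) := by
    rw [← pow_succ']; exact Nat.pow_le_pow_right (by omega) (by omega)
  have h5 : N * n ^ 3 ≤ n ^ (p + q + 2) := (Nat.mul_le_mul_right _ hN).trans h3
  generalize n ^ (p + q + 2) = A at *
  have hk : A ≤ (p + q) * A := Nat.le_mul_of_pos_left _ (by omega)
  have h6 : (p + q) * (n * n ^ 3) ≤ (p + q) * A := Nat.mul_le_mul_left _ h4
  have h7 : (p + q) * 1 ≤ (p + q) * A := Nat.mul_le_mul_left _ h1
  rw [add_mul, mul_assoc]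
  omega

/-! ### Simulation -/

/-- The marked graph whose normalized colorings are the evaluations at the points of `Fin N`. -/
def evalMarkedGraph {p q N n : ℕ} [Nonempty (Fin N)] (X : Fin p ⊕ Fin q → Fin N → Fin n) :
    MarkedGraph p q n where
  V := Vert (Fin p ⊕ Fin q) N n
  finite := inferInstance
  graph := evalGraph (eval X)
  x i := .inl (.inl (.inl i))
  y j := .inl (.inl (.inr j))
  ref c := .inl (.inr c)
  marking_injective := by
    rintro (a | a | a) (b | b | b) h <;> simp_all

theorem refClique_evalMarkedGraph {p q N n : ℕ} [Nonempty (Fin N)]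
    (X : Fin p ⊕ Fin q → Fin N → Fin n) : (evalMarkedGraph X).RefClique := by
  rintro _ ⟨a, rfl⟩ _ ⟨b, rfl⟩ hab d h
  exact hab (congrArg _ h)

/-- Normalized colorings correspond to points of the domain, and the input colors determine the
point. -/
theorem simulates_evalMarkedGraph {p q m n N : ℕ} [Nonempty (Fin N)] (hmn : m ≤ n) (hn : 3 ≤ n)
    (φ : (Fin p → Fin m) →. (Fin q → Fin m)) (e : Fin N ≃ φ.Dom) :
    Simulates (evalMarkedGraph (Sum.elim (fun i z => Fin.castLE hmn ((e z : Fin p → Fin m) i))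
      (fun j z => Fin.castLE hmn (φ.fn _ (e z).2 j)))) φ := by
  set X : Fin p ⊕ Fin q → Fin N → Fin n :=
    Sum.elim (fun i z => Fin.castLE hmn ((e z : Fin p → Fin m) i))
      (fun j z => Fin.castLE hmn (φ.fn _ (e z).2 j))
  have main : ∀ (a : Fin p → Fin n) (σ : (evalMarkedGraph X).graph.Coloring (Fin n)),
      (evalMarkedGraph X).Extends a σ →
        ∃ d, (∀ v, σ v = eval X v d) ∧ ∀ i, a i = Fin.castLE hmn ((e d : Fin p → Fin m) i) := by
    intro a σ hσ
    obtain ⟨d, hd⟩ := coloring_eq_eval X hn σ hσ.2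
    exact ⟨d, hd, fun i => (hσ.1 i).symm.trans (hd _)⟩
  refine ⟨⟨evalColoring (eval X) (Classical.arbitrary _)⟩, ?_, ?_, ?_, ?_⟩
  · intro σ a b hab
    by_contra hne
    refine σ.valid (v := (evalMarkedGraph X).ref a) (w := (evalMarkedGraph X).ref b) ?_ hab
    exact fun _ => hne
  · intro a
    constructor
    · rintro ⟨σ, hσ⟩
      obtain ⟨d, -, hd⟩ := main a σ hσ
      exact ⟨_, (e d).2, fun j => by rw [hd]; rfl⟩
    · rintro ⟨s, hs, has⟩
      refine ⟨evalColoring (eval X) (e.symm ⟨s, hs⟩), fun j => ?_, fun _ => rfl⟩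
      change Fin.castLE hmn ((e (e.symm ⟨s, hs⟩) : Fin p → Fin m) j) = a j
      rw [Equiv.apply_symm_apply]
      exact Fin.ext (has j).symm
  · intro a σ τ hσ hτ
    obtain ⟨d, hd, hda⟩ := main a σ hσ
    obtain ⟨d', hd', hda'⟩ := main a τ hτ
    have : d = d' := by
      apply e.injective
      apply Subtype.ext
      funext i
      exact Fin.castLE_injective hmn ((hda i).symm.trans (hda' i))
    subst this
    exact RelHom.ext fun v => (hd v).trans (hd' v).symm
  · intro a σ hσ
    obtain ⟨d, hd, hda⟩ := main a σ hσ
    refine ⟨_, φ.fn _ (e d).2, fun j => by rw [hda]; rfl, Part.get_mem _, fun j => ?_⟩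
    exact congrArg Fin.val (hd ((evalMarkedGraph X).y j))

end ColoringSim

theorem mainTheorem1 :
    ∃ K : ℕ, ∀ (p q m n : ℕ), 1 ≤ p → 1 ≤ q → 2 ≤ m → max m 3 ≤ n →
      ∀ φ : (Fin p → Fin m) →. (Fin q → Fin m), φ.Dom.Nonempty →
        ∃ M : ColoringSim.MarkedGraph p q n,
          M.RefClique ∧ ColoringSim.Simulates M φ ∧
          ∀ (m' : ℕ) (hm' : m ≤ m') (s₀ : Fin m)
            (π : Equiv.Perm (Fin (p + q) → Fin m')) (Θ : ℕ),
            ColoringSim.IsInvertibleExtension hm' (Nat.le_add_left q p) s₀ φ π →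
            ColoringSim.IsProductOfTranspositions π Θ →
              M.numVertices ≤ K * (max 1 Θ * (p + q) * n ^ (2 * (p + q) + 4)) ∧
              M.numEdges ≤ K * (max 1 Θ * (p + q) * n ^ (3 * (p + q) + 5)) := by
  -- The constant is `4 ^ 2`: edges are bounded by the square of the vertex count.
  refine ⟨16, fun p q m n hp hq hm hmn φ hφ => ?_⟩
  obtain ⟨hmn, hn⟩ := max_le_iff.mp hmn
  let e : Fin (Nat.card φ.Dom) ≃ φ.Dom := (Finite.equivFin _).symm
  have : Nonempty (Fin (Nat.card φ.Dom)) := hφ.to_subtype.map e.symm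
  refine ⟨_, ColoringSim.refClique_evalMarkedGraph _,
    ColoringSim.simulates_evalMarkedGraph hmn hn φ e, ?_⟩
  intro m' _ s₀ π Θ _ _
  have hN : Nat.card φ.Dom ≤ n ^ p := by
    have h1 : Nat.card φ.Dom ≤ m ^ p := by
      have := Nat.card_le_card_of_injective (Subtype.val : φ.Dom → (Fin p → Fin m))
        Subtype.val_injective
      rwa [Nat.card_fun, Nat.card_fin, Nat.card_fin] at this
    exact h1.trans (Nat.pow_le_pow_left hmn p)
  have hV := ColoringSim.card_vert_le hp hq hn hN
  have hΘ : p + q ≤ max 1 Θ * (p + q) := Nat.le_mul_of_pos_left _ (by omega)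
  constructor
  · refine hV.trans (Nat.mul_le_mul (by norm_num) (Nat.mul_le_mul hΘ ?_))
    exact Nat.pow_le_pow_right (by omega) (by omega)
  -- Squaring leaves a second factor `p + q`, absorbed into `n ^ (p + q)`.
  · have hk : p + q ≤ n ^ (p + q) := (Nat.lt_pow_self (by omega)).le
    refine (ColoringSim.ncard_edgeSet_le_sq (V := ColoringSim.Vert (Fin p ⊕ Fin q) _ n) _).trans ?_
    calc _ ≤ (4 * ((p + q) * n ^ (p + q + 2))) ^ 2 := Nat.pow_le_pow_left hV 2
      _ = 16 * ((p + q) * ((p + q) * n ^ (2 * (p + q) + 4))) := by ring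
      _ ≤ 16 * ((p + q) * (n ^ (p + q) * n ^ (2 * (p + q) + 4))) := by gcongr
      _ = 16 * ((p + q) * n ^ (3 * (p + q) + 4)) := by ring
      _ ≤ _ := by
        refine Nat.mul_le_mul_left _ (Nat.mul_le_mul hΘ ?_)
        exact Nat.pow_le_pow_right (by omega) (by omega)
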